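/- Let $K$ be a field, let $S = K[X_1,\dots,X_n]$ be a polynomial ring, and let $I \subset S$ be a Stanley--Reisner ideal, i.e. an ideal generated by square-free monomials. Put $R = S/I$ and $\mathfrak m = (x_1,\dots,x_n) \subset R$, where $x_j$ is the image of $X_j$, and let $H^i_{\mathfrak m}(R)$ denote the $i$-th local cohomology module of $R$ with respect to $\mathfrak m$. If $R$ is generalized Cohen--Macaulay, i.e. $H^i_{\mathfrak m}(R)$ has finite length for every $i \neq \dim R$, then $R$ is $1$-Buchsbaum, i.e. $\mathfrak m\, H^i_{\mathfrak m}(R) = 0$ for every $i \neq \dim R$. -/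

import Mathlib

universe u

/-- An ideal of `K[X_1, …, X_n]` is a Stanley–Reisner ideal if it is a square-free monomial ideal,
i.e. it is generated by a set of square-free monomials `∏_{j ∈ F} X_j` with `F ⊆ {1, …, n}`. -/
def IsStanleyReisnerIdeal {K : Type u} [Field K] {n : ℕ} (I : Ideal (MvPolynomial (Fin n) K)) :
    Prop :=
  ∃ G : Set (Finset (Fin n)),
    I = Ideal.span ((fun F : Finset (Fin n) => ∏ j ∈ F, (MvPolynomial.X j : MvPolynomial (Fin n) K)) '' G)

/-- The ideal `𝔪 = (x_1, …, x_n)` of `R = K[X_1, …, X_n] / I`, where `x_j` is the image of `X_j`. -/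
noncomputable def gradedMaximalIdeal {K : Type u} [Field K] {n : ℕ} (I : Ideal (MvPolynomial (Fin n) K)) :
    Ideal (MvPolynomial (Fin n) K ⧸ I) :=
  Ideal.span (Set.range fun j : Fin n => Ideal.Quotient.mk I (MvPolynomial.X j))

/-- The local cohomology module `H^i_𝔪(R)` of the ring `R` with support in the ideal `𝔪`. -/
noncomputable abbrev ringLocalCohomology {R : Type u} [CommRing R] (𝔪 : Ideal R) (i : ℕ) :
    ModuleCat.{u} R :=
  (localCohomology 𝔪 i).obj (ModuleCat.of R R)

/-- `R` is generalized Cohen–Macaulay (with respect to `𝔪`) if `H^i_𝔪(R)` has finite length for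
all `i ≠ dim R`. -/
def IsGeneralizedCohenMacaulay {R : Type u} [CommRing R] (𝔪 : Ideal R) : Prop :=
  ∀ i : ℕ, (i : WithBot ℕ∞) ≠ ringKrullDim R → IsFiniteLength R (ringLocalCohomology 𝔪 i)

/-- `R` is `k`-Buchsbaum (with respect to `𝔪`) if `𝔪 ^ k` annihilates `H^i_𝔪(R)` for
all `i ≠ dim R`. -/
def IsKBuchsbaum {R : Type u} [CommRing R] (𝔪 : Ideal R) (k : ℕ) : Prop :=
  ∀ i : ℕ, (i : WithBot ℕ∞) ≠ ringKrullDim R →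
    ∀ r ∈ 𝔪 ^ k, ∀ h : ringLocalCohomology 𝔪 i, r • h = 0

/-! For `k ≥ 1` let `F` be the endomorphism `x_j ↦ x_j ^ k` of `R` (`expandEnd`) and write `F_*` for
restriction of scalars along it. As a map `R → F_*R` it is split by taking `k`-th roots of monomials
(`contractEnd`), which preserves `I` because the generators are square-free. Since `x_j` acts on
`F_*R` as `x_j ^ k`, multiplication by `x_j` on `R` factors as `R → F_*R → F_*R → R` with middle map
`x_j ^ k`. Finite length provides a `k` for which `x_j ^ k` kills `H^i(R)`. If it also induces zero
on `H^i(F_*R)`, then `x_j` kills `H^i(R)`.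

That transfer is `ExtColimMapZero.restrictScalars`: a map inducing zero on `H^i` still does so after
`F_*`, as `F(𝔪)R` and `𝔪` have the same radical. The proof shifts dimensions along `M ⊆ Hom_K(R,
M)`. Both `Hom_K(R, M)` and its `F_*` have the form `Hom_K(P, V)` with `P` finite over `R`, and such
modules have no higher local cohomology by Artin–Rees (`Coind.extColimAcyclic`). The dictionary
between local cohomology and `Abelian.Ext` is `localCohomology.map_eq_zero_iff`. -/

open CategoryTheory Limits Opposite

/-! ### Cocycle representatives for the derived-functor `Ext`. -/

namespace OldExt

variable {R : Type u} [CommRing R]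

/-- The functor `Hom(-, M)`, with values in the opposite category of modules. -/
noncomputable abbrev homTo (M : ModuleCat.{u} R) : ModuleCat.{u} R ⥤ (ModuleCat.{u} R)ᵒᵖ :=
  ((linearYoneda R (ModuleCat.{u} R)).obj M).rightOp

variable {N N' : ModuleCat.{u} R} (P : ProjectiveResolution N) (P' : ProjectiveResolution N')
  (M M' : ModuleCat.{u} R) (n : ℕ)

/-- The complex `Hom(P, M)`, as a chain complex in the opposite category of modules. -/
noncomputable abbrev homComplex : ChainComplex (ModuleCat.{u} R)ᵒᵖ ℕ :=
  ((homTo M).mapHomologicalComplex _).obj P.complex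

/-- The inclusion of the `n`-cocycles of `Hom(P, M)` into `Hom(P_n, M)`. -/
noncomputable def cocycleι : (unop ((homComplex P M).opcycles n) : ModuleCat.{u} R) →ₗ[R]
    (P.complex.X n ⟶ M) :=
  ((homComplex P M).pOpcycles n).unop.hom

/-- The derived functor of `Hom(-, M)` is computed by the complex `Hom(P, M)`. -/
noncomputable def derivedIso :
    ((homTo M).leftDerived n).obj N ≅ (homComplex P M).homology n :=
  P.isoLeftDerivedObj (homTo M) n

/-- The map sending an `n`-cocycle of `Hom(P, M)` to its class in `Ext^n(N, M)`. -/
noncomputable def cocycleClass : (unop ((homComplex P M).opcycles n) : ModuleCat.{u} R) →ₗ[R]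
    (((Ext R (ModuleCat.{u} R) n).obj (op N)).obj M : ModuleCat.{u} R) :=
  ((derivedIso P M n).hom ≫ (homComplex P M).homologyι n).unop.hom

/-- The cocycle `z` represents the class `ξ`. -/
def Represents {P : ProjectiveResolution N} {M : ModuleCat.{u} R} {n : ℕ}
    (z : P.complex.X n ⟶ M)
    (ξ : (((Ext R (ModuleCat.{u} R) n).obj (op N)).obj M : ModuleCat.{u} R)) : Prop :=
  ∃ y, cocycleι P M n y = z ∧ cocycleClass P M n y = ξ

variable {P P' M M' n}

lemma cocycleClass_surjective : Function.Surjective (cocycleClass P M n) := by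
  have : Epi ((derivedIso P M n).hom ≫ (homComplex P M).homologyι n).unop :=
    inferInstance
  exact (ModuleCat.epi_iff_surjective _).1 this

lemma Represents.unique {z : P.complex.X n ⟶ M} {ξ ξ'} (h : Represents z ξ)
    (h' : Represents z ξ') : ξ = ξ' := by
  obtain ⟨y, rfl, rfl⟩ := h
  obtain ⟨y', h', rfl⟩ := h'
  have hinj : Function.Injective (cocycleι P M n) :=
    (ModuleCat.mono_iff_injective (((homComplex P M).pOpcycles n).unop)).1 inferInstance
  rw [hinj h']

lemma exists_represents (ξ : (((Ext R (ModuleCat.{u} R) n).obj (op N)).obj M : ModuleCat.{u} R)) :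
    ∃ z : P.complex.X n ⟶ M, P.complex.d (n + 1) n ≫ z = 0 ∧ Represents z ξ := by
  obtain ⟨y, rfl⟩ := cocycleClass_surjective (P := P) ξ
  refine ⟨_, ?_, y, rfl, rfl⟩
  have h := congrArg Quiver.Hom.unop ((homComplex P M).d_pOpcycles (n + 1) n)
  exact ConcreteCategory.congr_hom h y

lemma represents_of_cocycle (z : P.complex.X n ⟶ M) (hz : P.complex.d (n + 1) n ≫ z = 0) :
    ∃ ξ, Represents z ξ := by
  -- The element `z` becomes a map out of `R`, so that the universal property of opcycles (cocycles,
  -- after `unop`) applies.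
  let k : ModuleCat.of R R ⟶ ModuleCat.of R (P.complex.X n ⟶ M) :=
    ModuleCat.ofHom (LinearMap.toSpanSingleton R _ z)
  let k' : (homComplex P M).X n ⟶ op (ModuleCat.of R R) := k.op
  have hk : (homComplex P M).d (n + 1) n ≫ k' = 0 := by
    apply Quiver.Hom.unop_inj
    ext
    change P.complex.d (n + 1) n ≫ ((1 : R) • z) = 0
    rw [one_smul, hz]
  let l := (homComplex P M).descOpcycles k' (n + 1) (by simp) hk
  refine ⟨_, l.unop.hom (1 : R), ?_, rfl⟩
  have h := congrArg Quiver.Hom.unop ((homComplex P M).p_descOpcycles k' (n + 1) (by simp) hk)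
  have h2 := ConcreteCategory.congr_hom h (1 : R)
  refine Eq.trans h2 ?_
  exact one_smul R z

/-- Using `next n` covers all degrees at once: `next 0 = 0` and `d 0 0 = 0`, so for `n = 0` the
right-hand side reads `z = 0`. -/
lemma Represents.eq_zero_iff {z : P.complex.X n ⟶ M} {ξ} (h : Represents z ξ) :
    ξ = 0 ↔ ∃ w : P.complex.X ((ComplexShape.down ℕ).next n) ⟶ M, P.complex.d n _ ≫ w = z := by
  obtain ⟨y, rfl, rfl⟩ := h
  set K := homComplex P M
  set j := (ComplexShape.down ℕ).next n
  have ex : (ShortComplex.mk (K.homologyι n) (K.fromOpcycles n j) (by simp)).Exact :=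
    ShortComplex.exact_of_f_is_kernel _ (K.homologyIsKernel n j rfl)
  have ex2 := (ShortComplex.moduleCat_exact_iff _).1 ex.unop
  have hinj : Function.Injective (cocycleι P M n) :=
    (ModuleCat.mono_iff_injective ((K.pOpcycles n).unop)).1 inferInstance
  have hcls : cocycleClass P M n y = 0 ↔ (K.homologyι n).unop.hom y = 0 := by
    have : Function.Injective (derivedIso P M n).hom.unop.hom :=
      (ModuleCat.mono_iff_injective _).1 inferInstance
    exact map_eq_zero_iff _ this
  have hd (w : P.complex.X j ⟶ M) :
      cocycleι P M n ((K.fromOpcycles n j).unop.hom w) = P.complex.d n j ≫ w := by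
    have h := congrArg Quiver.Hom.unop (K.p_fromOpcycles n j)
    exact ConcreteCategory.congr_hom h w
  rw [hcls]
  constructor
  · intro hy
    obtain ⟨w, hw⟩ := ex2 y hy
    exact ⟨w, (hd w).symm.trans (congrArg _ hw)⟩
  · rintro ⟨w, hw⟩
    rw [← hd] at hw
    rw [← hinj hw]
    have h := congrArg Quiver.Hom.unop
      (ShortComplex.mk (K.homologyι n) (K.fromOpcycles n j) (by simp)).zero
    exact ConcreteCategory.congr_hom h w

lemma Represents.map {z : P.complex.X n ⟶ M} {ξ} (h : Represents z ξ) (f : M ⟶ M') :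
    Represents (z ≫ f) ((((Ext R (ModuleCat.{u} R) n).obj (op N)).map f).hom ξ) := by
  obtain ⟨y, rfl, rfl⟩ := h
  let α : homTo M' ⟶ homTo M := NatTrans.rightOp ((linearYoneda R (ModuleCat.{u} R)).map f)
  let ψ : homComplex P M' ⟶ homComplex P M := (NatTrans.mapHomologicalComplex α _).app P.complex
  refine ⟨(HomologicalComplex.opcyclesMap ψ n).unop.hom y, ?_, ?_⟩
  · have h := congrArg Quiver.Hom.unop (HomologicalComplex.p_opcyclesMap ψ n)
    exact ConcreteCategory.congr_hom h y
  · have h1 : (NatTrans.leftDerived α n).app N ≫ (derivedIso P M n).hom =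
        (derivedIso P M' n).hom ≫ HomologicalComplex.homologyMap ψ n := by
      rw [← Iso.eq_comp_inv, Category.assoc]
      exact ProjectiveResolution.leftDerived_app_eq α P n
    have h2 : (NatTrans.leftDerived α n).app N ≫ (derivedIso P M n).hom ≫
        (homComplex P M).homologyι n = ((derivedIso P M' n).hom ≫
        (homComplex P M').homologyι n) ≫ HomologicalComplex.opcyclesMap ψ n := by
      rw [reassoc_of% h1, HomologicalComplex.homologyι_naturality, Category.assoc]
    have h := congrArg Quiver.Hom.unop h2
    exact (ConcreteCategory.congr_hom h y).symm

lemma Represents.precomp {z : P.complex.X n ⟶ M} {ξ} (h : Represents z ξ) {g : N' ⟶ N}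
    (φ : ProjectiveResolution.Hom P' P g) :
    Represents (φ.hom.f n ≫ z) ((((Ext R (ModuleCat.{u} R) n).map g.op).app M).hom ξ) := by
  obtain ⟨y, rfl, rfl⟩ := h
  let ψ : homComplex P' M ⟶ homComplex P M := ((homTo M).mapHomologicalComplex _).map φ.hom
  refine ⟨(HomologicalComplex.opcyclesMap ψ n).unop.hom y, ?_, ?_⟩
  · have h := congrArg Quiver.Hom.unop (HomologicalComplex.p_opcyclesMap ψ n)
    exact ConcreteCategory.congr_hom h y
  · have h1 : ((homTo M).leftDerived n).map g ≫ (derivedIso P M n).hom =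
        (derivedIso P' M n).hom ≫ HomologicalComplex.homologyMap ψ n :=
      ProjectiveResolution.isoLeftDerivedObj_hom_naturality g P' P φ.hom
        φ.hom_f_zero_comp_π_f_zero _ n
    have h2 : ((homTo M).leftDerived n).map g ≫ (derivedIso P M n).hom ≫
        (homComplex P M).homologyι n = ((derivedIso P' M n).hom ≫
        (homComplex P' M).homologyι n) ≫ HomologicalComplex.opcyclesMap ψ n := by
      rw [reassoc_of% h1, HomologicalComplex.homologyι_naturality, Category.assoc]
    have h := congrArg Quiver.Hom.unop h2
    exact (ConcreteCategory.congr_hom h y).symm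

lemma Represents.smul {z : P.complex.X n ⟶ M} {ξ} (h : Represents z ξ) (r : R) :
    Represents (r • z) (r • ξ) := by
  obtain ⟨y, rfl, rfl⟩ := h
  exact ⟨r • y, map_smul _ _ _, map_smul _ _ _⟩

end OldExt

/-! ### Coboundaries in `Abelian.Ext`, and vanishing on the colimit of Ext groups. -/

section

variable {R : Type u} [CommRing R]

lemma CategoryTheory.ProjectiveResolution.extMk_eq_zero_iff_next {N M : ModuleCat.{u} R}
    (P : ProjectiveResolution N) {n : ℕ} (z : P.complex.X n ⟶ M)
    (hz : P.complex.d (n + 1) n ≫ z = 0) :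
    P.extMk z (n + 1) rfl hz = 0 ↔
      ∃ w : P.complex.X ((ComplexShape.down ℕ).next n) ⟶ M, P.complex.d n _ ≫ w = z := by
  cases n with
  | succ p =>
    rw [P.extMk_eq_zero_iff z (p + 1 + 1) rfl hz p rfl]
    have hp : (ComplexShape.down ℕ).next (p + 1) = p := by simp
    rw [hp]
  | zero =>
    have hd : P.complex.d 0 ((ComplexShape.down ℕ).next 0) = 0 :=
      P.complex.shape _ _ (by simp)
    simp only [hd, zero_comp, exists_const]
    refine ⟨fun h => ?_, fun h => ?_⟩
    · simp only [← P.extEquivCohomologyClass.apply_eq_iff_eq,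
        ProjectiveResolution.extEquivCohomologyClass_extMk,
        ProjectiveResolution.extEquivCohomologyClass_zero,
        CochainComplex.HomComplex.CohomologyClass.mk_eq_zero_iff] at h
      rw [CochainComplex.HomComplex.Cocycle.toSingleMk_mem_coboundaries_iff _ _ _ _ _ 1
        (by simp)] at h
      obtain ⟨g, hg⟩ := h
      -- The resolution lives in degrees `≤ 0`, so there are no nonzero coboundaries in degree `0`.
      have h1 : P.cochainComplex.d (-(0 : ℕ)) 1 = 0 := by
        have : IsZero (P.cochainComplex.X 1) :=
          P.cochainComplex.isZero_of_isStrictlyLE 0 1 (by simp)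
        exact this.eq_of_tgt _ _
      rw [h1, zero_comp] at hg
      rw [← cancel_epi (P.cochainComplexXIso (-(0 : ℕ)) 0 rfl).hom, ← hg, comp_zero]
    · subst h
      simp

/-- The `R`-module `R ⧸ J ^ t`. -/
noncomputable abbrev quotPow (J : Ideal R) (t : ℕ) : ModuleCat.{u} R :=
  ModuleCat.of R (R ⧸ J ^ t)

/-- The projection `R ⧸ J ^ s ⟶ R ⧸ J ^ t` for `t ≤ s`. -/
noncomputable def quotPowMap (J : Ideal R) {t s : ℕ} (h : t ≤ s) : quotPow J s ⟶ quotPow J t :=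
  ModuleCat.ofHom (Submodule.mapQ _ _ LinearMap.id (Ideal.pow_le_pow_right h))

/-- The morphism `f` induces the zero map on `colim_t Ext^i(R ⧸ J ^ t, -)`. -/
def ExtColimMapZero (J : Ideal R) (i : ℕ) {M M' : ModuleCat.{u} R} (f : M ⟶ M') : Prop :=
  ∀ (t : ℕ) (ξ : Abelian.Ext (quotPow J t) M i), ∃ (s : ℕ) (h : t ≤ s),
    (Abelian.Ext.mk₀ (quotPowMap J h)).comp (ξ.comp (Abelian.Ext.mk₀ f) (add_zero i))
      (zero_add i) = 0

end

/-! ### Local cohomology expressed through `Abelian.Ext`. -/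

namespace localCohomology

variable {R : Type u} [CommRing R] (J : Ideal R) (i : ℕ)

/-- The map from `Ext^i(R ⧸ J ^ t, M)` to local cohomology. -/
noncomputable def ofExt (t : ℕ) (M : ModuleCat.{u} R) :
    ((Ext R (ModuleCat.{u} R) i).obj (op (quotPow J t))).obj M ⟶ (localCohomology J i).obj M :=
  (colimit.ι (diagram (idealPowersDiagram J) i) (op (op t))).app M

variable {J i}

lemma ofExt_naturality (t : ℕ) {M M' : ModuleCat.{u} R} (f : M ⟶ M') :
    ofExt J i t M ≫ (localCohomology J i).map f =
      ((Ext R (ModuleCat.{u} R) i).obj (op (quotPow J t))).map f ≫ ofExt J i t M' :=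
  ((colimit.ι (diagram (idealPowersDiagram J) i) (op (op t))).naturality f).symm

lemma exists_ofExt_eq {M : ModuleCat.{u} R} (x : (localCohomology J i).obj M) :
    ∃ t ξ, (ofExt J i t M).hom ξ = x := by
  have := preservesSmallestFilteredColimits_of_preservesFilteredColimits
    (forget (ModuleCat.{u} R))
  have hc := isColimitOfPreserves ((evaluation _ _).obj M)
    (colimit.isColimit (diagram (idealPowersDiagram J) i))
  obtain ⟨⟨⟨t⟩⟩, ξ, h⟩ := Concrete.isColimit_exists_rep _ hc x
  exact ⟨t, ξ, h⟩

lemma ofExt_eq_zero_iff {t : ℕ} {M : ModuleCat.{u} R} (ξ) :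
    (ofExt J i t M).hom ξ = 0 ↔ ∃ (s : ℕ) (h : t ≤ s),
      (((Ext R (ModuleCat.{u} R) i).map (quotPowMap J h).op).app M).hom ξ = 0 := by
  have := preservesSmallestFilteredColimits_of_preservesFilteredColimits
    (forget (ModuleCat.{u} R))
  have hc := isColimitOfPreserves ((evaluation _ _).obj M)
    (colimit.isColimit (diagram (idealPowersDiagram J) i))
  have key := Concrete.isColimit_rep_eq_iff_exists _ hc (i := op (op t)) (j := op (op t)) ξ 0
  have h0 : (ofExt J i t M).hom ξ = 0 ↔ (ofExt J i t M).hom ξ = (ofExt J i t M).hom 0 := by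
    rw [map_zero]
  refine h0.trans (key.trans ⟨?_, ?_⟩)
  · rintro ⟨⟨⟨s⟩⟩, f, g, hfg⟩
    refine ⟨s, f.unop.unop.down.down, ?_⟩
    refine Eq.trans hfg ?_
    exact map_zero _
  · rintro ⟨s, h, hs⟩
    refine ⟨op (op s), (homOfLE h).op.op, (homOfLE h).op.op, Eq.trans hs ?_⟩
    exact (map_zero _).symm

lemma map_ofExt {t : ℕ} {M M' : ModuleCat.{u} R} (f : M ⟶ M') (ξ) :
    ((localCohomology J i).map f).hom ((ofExt J i t M).hom ξ) =
      (ofExt J i t M').hom ((((Ext R (ModuleCat.{u} R) i).obj (op (quotPow J t))).map f).hom ξ) :=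
  ConcreteCategory.congr_hom (ofExt_naturality t f) ξ

/-- In both versions of Ext, restriction along `quotPowMap` precomposes the cocycle with a lift to
resolutions, and a class vanishes exactly when its cocycle is a coboundary. Thus no isomorphism
between the two Ext groups is needed. -/
lemma ofExt_eq_zero_iff_of_represents {t : ℕ} {M : ModuleCat.{u} R}
    {P : ProjectiveResolution (quotPow J t)} {z : P.complex.X i ⟶ M}
    (hz : P.complex.d (i + 1) i ≫ z = 0) {ξ} (h : OldExt.Represents z ξ) :
    (ofExt J i t M).hom ξ = 0 ↔ ∃ (s : ℕ) (h : t ≤ s),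
      (Abelian.Ext.mk₀ (quotPowMap J h)).comp (P.extMk z (i + 1) rfl hz) (zero_add i) = 0 := by
  rw [ofExt_eq_zero_iff]
  refine exists_congr fun s => exists_congr fun hs => ?_
  let φ : ProjectiveResolution.Hom (projectiveResolution (quotPow J s)) P (quotPowMap J hs) :=
    ⟨ProjectiveResolution.lift (quotPowMap J hs) _ _, by
      rw [ProjectiveResolution.lift_commutes_zero]; rfl⟩
  rw [ProjectiveResolution.mk₀_comp_extMk z (i + 1) rfl hz φ,
    ProjectiveResolution.extMk_eq_zero_iff_next]
  exact (h.precomp φ).eq_zero_iff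

theorem map_eq_zero_iff {M M' : ModuleCat.{u} R} (f : M ⟶ M') :
    (localCohomology J i).map f = 0 ↔ ExtColimMapZero J i f := by
  constructor
  · intro hf t ξ
    obtain ⟨z, hz, rfl⟩ := (projectiveResolution (quotPow J t)).extMk_surjective ξ (i + 1) rfl
    obtain ⟨ζ, hζ⟩ := OldExt.represents_of_cocycle z hz
    have h0 : ((localCohomology J i).map f).hom ((ofExt J i t M).hom ζ) = 0 := by
      rw [hf]; rfl
    rw [map_ofExt, ofExt_eq_zero_iff_of_represents (by rw [reassoc_of% hz, zero_comp])
      (hζ.map f)] at h0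
    simpa only [ProjectiveResolution.extMk_comp_mk₀] using h0
  · intro hf
    ext x
    obtain ⟨t, ζ, rfl⟩ := exists_ofExt_eq x
    obtain ⟨z, hz, hζ⟩ := OldExt.exists_represents (P := projectiveResolution (quotPow J t)) ζ
    have h0 := hf t ((projectiveResolution (quotPow J t)).extMk z (i + 1) rfl hz)
    simp only [ProjectiveResolution.extMk_comp_mk₀] at h0
    rw [← ofExt_eq_zero_iff_of_represents (by rw [reassoc_of% hz, zero_comp]) (hζ.map f),
      ← map_ofExt] at h0
    exact h0

/-- Both operations multiply a representing cocycle by `r`. -/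
lemma map_smul_id (M : ModuleCat.{u} R) (r : R) (x : (localCohomology J i).obj M) :
    ((localCohomology J i).map (r • 𝟙 M)).hom x = r • x := by
  obtain ⟨t, ζ, rfl⟩ := exists_ofExt_eq x
  obtain ⟨y, rfl⟩ := OldExt.cocycleClass_surjective (P := projectiveResolution (quotPow J t)) ζ
  rw [map_ofExt, ← map_smul]
  congr 1
  have h1 := (OldExt.Represents.map ⟨y, rfl, rfl⟩ (r • 𝟙 M))
  have h2 := OldExt.Represents.smul (P := projectiveResolution (quotPow J t)) ⟨y, rfl, rfl⟩ r
  rw [Linear.comp_smul, Category.comp_id] at h1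
  exact h1.unique h2

/-- A class coming from `Ext^i(R ⧸ J ^ t, M)` is killed by `J ^ t`: a scalar can be moved to the
first argument, where it acts as zero. -/
lemma exists_pow_smul_eq_zero {M : ModuleCat.{u} R} (x : (localCohomology J i).obj M) :
    ∃ t : ℕ, ∀ r ∈ J ^ t, r • x = 0 := by
  obtain ⟨t, ζ, rfl⟩ := exists_ofExt_eq x
  refine ⟨t, fun r hr => ?_⟩
  obtain ⟨z, hz, hζ⟩ := OldExt.exists_represents (P := projectiveResolution (quotPow J t)) ζ
  rw [← map_smul, ofExt_eq_zero_iff_of_represents (by rw [Linear.comp_smul, hz, smul_zero])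
    (hζ.smul r)]
  refine ⟨t, le_rfl, ?_⟩
  have h1 : (projectiveResolution (quotPow J t)).extMk (r • z) (i + 1) rfl
      (by rw [Linear.comp_smul, hz, smul_zero]) =
      (Abelian.Ext.mk₀ (r • 𝟙 (quotPow J t))).comp
        ((projectiveResolution (quotPow J t)).extMk z (i + 1) rfl hz) (zero_add i) := by
    have e : r • z = z ≫ (r • 𝟙 M) := by simp
    rw [Abelian.Ext.mk₀_smul, Abelian.Ext.smul_comp, Abelian.Ext.mk₀_id_comp,
      Abelian.Ext.smul_eq_comp_mk₀, ProjectiveResolution.extMk_comp_mk₀]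
    simp only [e]
  have h2 : r • 𝟙 (quotPow J t) = 0 := by
    refine ModuleCat.hom_ext (LinearMap.ext fun v => ?_)
    obtain ⟨v, rfl⟩ := Ideal.Quotient.mk_surjective v
    change r • (Ideal.Quotient.mk (J ^ t) v) = 0
    rw [Algebra.smul_def, Ideal.Quotient.algebraMap_eq, ← map_mul]
    exact Ideal.Quotient.eq_zero_iff_mem.2 (Ideal.mul_mem_right _ _ hr)
  rw [h1, h2, Abelian.Ext.mk₀_zero, Abelian.Ext.zero_comp, Abelian.Ext.comp_zero]

end localCohomology

/-! ### Dimension shifting in the colimit of Ext groups. -/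

section ExtColim

variable {R : Type u} [CommRing R] {J : Ideal R}

@[simp]
lemma quotPowMap_comp {t s r : ℕ} (h : t ≤ s) (h' : s ≤ r) :
    quotPowMap J h' ≫ quotPowMap J h = quotPowMap J (h.trans h') := by
  refine ModuleCat.hom_ext (LinearMap.ext fun v => ?_)
  obtain ⟨v, rfl⟩ := Ideal.Quotient.mk_surjective v
  rfl

/-- Restriction of classes along the projections `R ⧸ J ^ s ⟶ R ⧸ J ^ t`. -/
noncomputable def extRes {t s : ℕ} (h : t ≤ s) {M : ModuleCat.{u} R} {i : ℕ}
    (ξ : Abelian.Ext (quotPow J t) M i) : Abelian.Ext (quotPow J s) M i :=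
  (Abelian.Ext.mk₀ (quotPowMap J h)).comp ξ (zero_add i)

lemma extRes_extRes {t s r : ℕ} (h : t ≤ s) (h' : s ≤ r) {M : ModuleCat.{u} R} {i : ℕ}
    (ξ : Abelian.Ext (quotPow J t) M i) :
    extRes h' (extRes h ξ) = extRes (h.trans h') ξ := by
  simp only [extRes, Abelian.Ext.mk₀_comp_mk₀_assoc, quotPowMap_comp]

lemma extRes_comp {t s : ℕ} (h : t ≤ s) {M M' : ModuleCat.{u} R} {i j k : ℕ}
    (ξ : Abelian.Ext (quotPow J t) M i) (η : Abelian.Ext M M' j) (hk : i + j = k) :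
    extRes h (ξ.comp η hk) = (extRes h ξ).comp η hk := by
  simp only [extRes]
  rw [Abelian.Ext.comp_assoc]
  omega

lemma extRes_mk₀ {t s : ℕ} (h : t ≤ s) {M : ModuleCat.{u} R} (g : quotPow J t ⟶ M) :
    extRes h (Abelian.Ext.mk₀ g) = Abelian.Ext.mk₀ (quotPowMap J h ≫ g) :=
  Abelian.Ext.mk₀_comp_mk₀ _ _

/-- The morphism `R ⧸ J ^ t ⟶ M` corresponding to an element killed by `J ^ t`. -/
noncomputable def homOfTorsion {M : ModuleCat.{u} R} {t : ℕ} (x : M)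
    (hx : ∀ r ∈ J ^ t, r • x = 0) : quotPow J t ⟶ M :=
  ModuleCat.ofHom (Submodule.liftQ (J ^ t) (LinearMap.toSpanSingleton R M x) hx)

lemma homOfTorsion_one {M : ModuleCat.{u} R} {t : ℕ} (x : M)
    (hx : ∀ r ∈ J ^ t, r • x = 0) :
    (homOfTorsion x hx).hom (Ideal.Quotient.mk (J ^ t) 1) = x :=
  one_smul R x

lemma quotPow_hom_ext {M : ModuleCat.{u} R} {t : ℕ} {f g : quotPow J t ⟶ M}
    (h : f.hom (Ideal.Quotient.mk (J ^ t) 1) = g.hom (Ideal.Quotient.mk (J ^ t) 1)) : f = g := by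
  refine ModuleCat.hom_ext (LinearMap.ext fun v => ?_)
  obtain ⟨v, rfl⟩ := Ideal.Quotient.mk_surjective v
  have e : Ideal.Quotient.mk (J ^ t) v = v • Ideal.Quotient.mk (J ^ t) 1 := by
    rw [Algebra.smul_def, map_one, mul_one, Ideal.Quotient.algebraMap_eq]
  rw [e, map_smul, map_smul, h]

lemma smul_apply_one_eq_zero {M : ModuleCat.{u} R} {t : ℕ} (f : quotPow J t ⟶ M) {r : R}
    (hr : r ∈ J ^ t) : r • f.hom (Ideal.Quotient.mk (J ^ t) 1) = 0 := by
  have e : r • Ideal.Quotient.mk (J ^ t) 1 = 0 := by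
    rw [Algebra.smul_def, map_one, mul_one, Ideal.Quotient.algebraMap_eq,
      Ideal.Quotient.eq_zero_iff_mem.2 hr]
  rw [← map_smul]
  exact (congrArg f.hom e).trans (map_zero _)

variable (J) in
/-- The modules `colim_t Ext^i(R ⧸ J ^ t, X)` vanish for `0 < i`. -/
def ExtColimAcyclic (X : ModuleCat.{u} R) : Prop :=
  ∀ (i t : ℕ) (ξ : Abelian.Ext (quotPow J t) X (i + 1)), ∃ (s : ℕ) (h : t ≤ s), extRes h ξ = 0

lemma ExtColimAcyclic.of_iso {X Y : ModuleCat.{u} R} (e : X ≅ Y) (h : ExtColimAcyclic J X) :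
    ExtColimAcyclic J Y := by
  intro i t ξ
  obtain ⟨s, hs, h0⟩ := h i t (ξ.comp (Abelian.Ext.mk₀ e.inv) (add_zero _))
  refine ⟨s, hs, ?_⟩
  rw [extRes_comp] at h0
  have h1 := congrArg (fun ζ => ζ.comp (Abelian.Ext.mk₀ e.hom) (add_zero _)) h0
  simpa using h1

/-- The image of `colim_t Ext^i(R ⧸ J ^ t, -)` of the third component of `φ` lands in the image
of the middle term. -/
def ExtColimFactors (J : Ideal R) (i : ℕ) {S S' : ShortComplex (ModuleCat.{u} R)} (φ : S ⟶ S') :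
    Prop :=
  ∀ (t : ℕ) (ζ : Abelian.Ext (quotPow J t) S.X₃ i), ∃ (s : ℕ) (h : t ≤ s)
    (η : Abelian.Ext (quotPow J s) S'.X₂ i),
    extRes h (ζ.comp (Abelian.Ext.mk₀ φ.τ₃) (add_zero i)) =
      η.comp (Abelian.Ext.mk₀ S'.g) (add_zero i)

variable {S S' : ShortComplex (ModuleCat.{u} R)} (φ : S ⟶ S') {i : ℕ}

/-- By naturality of the connecting map, the image of `ζ` has zero boundary after restriction, so it
lifts to the middle term. -/
lemma ExtColimMapZero.factors (hS : S.ShortExact) (hS' : S'.ShortExact)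
    (h : ExtColimMapZero J (i + 1) φ.τ₁) : ExtColimFactors J i φ := by
  intro t ζ
  obtain ⟨s, hs, h0⟩ := h t (ζ.comp hS.extClass rfl)
  refine ⟨s, hs, ?_⟩
  rw [Abelian.Ext.comp_assoc_of_third_deg_zero, hS.extClass_naturality hS' φ,
    ← Abelian.Ext.comp_assoc_of_second_deg_zero] at h0
  change extRes hs _ = 0 at h0
  rw [extRes_comp] at h0
  obtain ⟨η, hη⟩ := Abelian.Ext.covariant_sequence_exact₃ _ hS' _ rfl h0
  exact ⟨η, hη.symm⟩

/-- Acyclicity of the middle term makes `ξ`, after restriction, the boundary of some `ζ`; the image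
of `ζ` comes from `S'.X₂` and hence has zero boundary. -/
lemma ExtColimFactors.mapZero (hS : S.ShortExact) (hS' : S'.ShortExact)
    (hac : ExtColimAcyclic J S.X₂) (h : ExtColimFactors J i φ) :
    ExtColimMapZero J (i + 1) φ.τ₁ := by
  intro t ξ
  obtain ⟨s, hs, h0⟩ := hac i t (ξ.comp (Abelian.Ext.mk₀ S.f) (add_zero _))
  rw [extRes_comp] at h0
  obtain ⟨ζ, hζ⟩ := Abelian.Ext.covariant_sequence_exact₁ _ hS _ h0 rfl
  obtain ⟨r, hr, η, hη⟩ := h s ζ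
  refine ⟨r, hs.trans hr, ?_⟩
  change extRes (hs.trans hr) _ = 0
  rw [extRes_comp, ← extRes_extRes hs hr, ← hζ, ← extRes_comp,
    Abelian.Ext.comp_assoc_of_third_deg_zero, hS.extClass_naturality hS' φ,
    ← Abelian.Ext.comp_assoc_of_second_deg_zero, extRes_comp, hη,
    Abelian.Ext.comp_assoc_of_second_deg_zero, hS'.comp_extClass, Abelian.Ext.comp_zero]

lemma ExtColimFactors.mapZero_τ₃ (hac : ExtColimAcyclic J S'.X₂)
    (h : ExtColimFactors J (i + 1) φ) : ExtColimMapZero J (i + 1) φ.τ₃ := by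
  intro t ζ
  obtain ⟨s, hs, η, hη⟩ := h t ζ
  obtain ⟨r, hr, h0⟩ := hac i s η
  refine ⟨r, hs.trans hr, ?_⟩
  change extRes (hs.trans hr) _ = 0
  rw [← extRes_extRes hs hr, hη, extRes_comp, h0, Abelian.Ext.zero_comp]

lemma ExtColimMapZero.factors_τ₃ (h : ExtColimMapZero J i φ.τ₃) : ExtColimFactors J i φ := by
  intro t ζ
  obtain ⟨s, hs, h0⟩ := h t ζ
  exact ⟨s, hs, 0, by rw [Abelian.Ext.zero_comp]; exact h0⟩

/-- A map from `R ⧸ J ^ t` is an element killed by `J ^ t`, so degree `0` is about `J`-power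
torsion. -/
lemma extColimMapZero_zero_iff {M M' : ModuleCat.{u} R} (f : M ⟶ M') :
    ExtColimMapZero J 0 f ↔ ∀ (t : ℕ) (x : M), (∀ r ∈ J ^ t, r • x = 0) → f.hom x = 0 := by
  constructor
  · intro h t x hx
    obtain ⟨s, hs, h0⟩ := h t (Abelian.Ext.mk₀ (homOfTorsion x hx))
    change extRes hs _ = 0 at h0
    rw [Abelian.Ext.mk₀_comp_mk₀, extRes_mk₀, Abelian.Ext.mk₀_eq_zero_iff] at h0
    have h1 := congrArg (fun g => g.hom (Ideal.Quotient.mk (J ^ s) 1)) h0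
    exact (congrArg f.hom (homOfTorsion_one x hx)).symm.trans h1
  · intro h t ζ
    obtain ⟨g, rfl⟩ := (Abelian.Ext.mk₀_bijective _ _).2 ζ
    refine ⟨t, le_rfl, ?_⟩
    have : g ≫ f = 0 := quotPow_hom_ext (h t _ fun r hr => smul_apply_one_eq_zero g hr)
    rw [Abelian.Ext.mk₀_comp_mk₀, this, Abelian.Ext.mk₀_zero, Abelian.Ext.comp_zero]

lemma extColimFactors_zero_iff : ExtColimFactors J 0 φ ↔
    ∀ (t : ℕ) (x : S.X₃), (∀ r ∈ J ^ t, r • x = 0) →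
      ∃ (s : ℕ) (y : S'.X₂), (∀ r ∈ J ^ s, r • y = 0) ∧ S'.g.hom y = φ.τ₃.hom x := by
  constructor
  · intro h t x hx
    obtain ⟨s, hs, η, h0⟩ := h t (Abelian.Ext.mk₀ (homOfTorsion x hx))
    obtain ⟨g, rfl⟩ := (Abelian.Ext.mk₀_bijective _ _).2 η
    rw [Abelian.Ext.mk₀_comp_mk₀, extRes_mk₀, Abelian.Ext.mk₀_comp_mk₀] at h0
    have h1 := congrArg (fun g => g.hom (Ideal.Quotient.mk (J ^ s) 1))
      ((Abelian.Ext.mk₀_bijective _ _).1 h0)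
    refine ⟨s, g.hom (Ideal.Quotient.mk (J ^ s) 1), fun r hr => smul_apply_one_eq_zero g hr, ?_⟩
    exact h1.symm.trans (congrArg φ.τ₃.hom (homOfTorsion_one x hx))
  · intro h t ζ
    obtain ⟨g, rfl⟩ := (Abelian.Ext.mk₀_bijective _ _).2 ζ
    obtain ⟨s, y, hy, hyx⟩ := h t _ fun r hr => smul_apply_one_eq_zero g hr
    refine ⟨max t s, le_max_left _ _, Abelian.Ext.mk₀ (homOfTorsion y fun r hr =>
      hy r (Ideal.pow_le_pow_right (le_max_right t s) hr)), ?_⟩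
    rw [Abelian.Ext.mk₀_comp_mk₀, extRes_mk₀, Abelian.Ext.mk₀_comp_mk₀]
    congr 1
    refine quotPow_hom_ext ?_
    exact hyx.symm.trans (congrArg S'.g.hom (homOfTorsion_one y _).symm)

lemma ExtColimMapZero.comp {A B C D : ModuleCat.{u} R} (f : A ⟶ B) {g : B ⟶ C} (k : C ⟶ D)
    (h : ExtColimMapZero J i g) : ExtColimMapZero J i (f ≫ g ≫ k) := by
  rw [← localCohomology.map_eq_zero_iff] at h ⊢
  simp [h]

end ExtColim

/-! ### Acyclicity of the modules `Hom_K(P, V)`. -/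

lemma LinearMap.exists_comp_eq_of_ker_le {K A B V : Type*} [Field K] [AddCommGroup A]
    [AddCommGroup B] [AddCommGroup V] [Module K A] [Module K B] [Module K V]
    (a : A →ₗ[K] B) (θ : A →ₗ[K] V) (h : LinearMap.ker a ≤ LinearMap.ker θ) :
    ∃ φ : B →ₗ[K] V, φ ∘ₗ a = θ := by
  obtain ⟨s, hs⟩ := a.rangeRestrict.exists_rightInverse_of_surjective a.range_rangeRestrict
  obtain ⟨φ, hφ⟩ := (θ ∘ₗ s).exists_extend
  refine ⟨φ, LinearMap.ext fun x => ?_⟩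
  have h1 : φ (a x) = θ (s (a.rangeRestrict x)) := LinearMap.congr_fun hφ (a.rangeRestrict x)
  have h2 : s (a.rangeRestrict x) - x ∈ LinearMap.ker a := by
    have := congrArg Subtype.val (LinearMap.congr_fun hs (a.rangeRestrict x))
    simpa [sub_eq_zero] using this
  have h3 := h h2
  rw [LinearMap.mem_ker, map_sub, sub_eq_zero] at h3
  rw [LinearMap.comp_apply, h1, h3]

/-- The space of `K`-linear maps `P → V`, with the `R`-module structure induced from `P`. -/
def Coind (K P V : Type*) [Field K] [AddCommGroup P] [Module K P] [AddCommGroup V] [Module K V] :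
    Type _ :=
  P →ₗ[K] V

namespace Coind

variable {K : Type*} [Field K] {R : Type u} [CommRing R] [Algebra K R]
variable {P Q V : Type u} [AddCommGroup P] [Module K P] [Module R P] [IsScalarTower K R P]
  [AddCommGroup Q] [Module K Q] [Module R Q] [IsScalarTower K R Q] [AddCommGroup V] [Module K V]

instance : AddCommGroup (Coind K P V) := inferInstanceAs (AddCommGroup (P →ₗ[K] V))

instance : FunLike (Coind K P V) P V := inferInstanceAs (FunLike (P →ₗ[K] V) P V)

instance : LinearMapClass (Coind K P V) K P V :=
  inferInstanceAs (LinearMapClass (P →ₗ[K] V) K P V)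

@[ext] lemma ext {φ ψ : Coind K P V} (h : ∀ x, φ x = ψ x) : φ = ψ := LinearMap.ext h

instance : Module R (Coind K P V) where
  smul r φ := LinearMap.comp φ (DistribSMul.toLinearMap K P r)
  one_smul φ := ext fun x => congrArg φ (one_smul R x)
  mul_smul r s φ := ext fun x => congrArg φ (by
    change (r * s) • x = s • r • x
    rw [mul_comm, mul_smul])
  smul_zero r := rfl
  smul_add r φ ψ := rfl
  add_smul r s φ := ext fun x => (congrArg φ (add_smul r s x)).trans (map_add φ _ _)
  zero_smul φ := ext fun x => (congrArg φ (zero_smul R x)).trans (map_zero φ)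

@[simp] lemma smul_apply (r : R) (φ : Coind K P V) (x : P) : (r • φ) x = φ (r • x) := rfl

variable (K V) in
/-- Precomposition with an `R`-linear map. -/
def precomp (a : P →ₗ[R] Q) : Coind K Q V →ₗ[R] Coind K P V where
  toFun φ := LinearMap.comp φ (a.restrictScalars K)
  map_add' _ _ := rfl
  map_smul' r φ := ext fun x => congrArg φ (a.map_smul r x).symm

lemma injective_of_basis {ι : Type*} [Fintype ι] (b : Module.Basis ι R P) :
    Injective (ModuleCat.of R (Coind K P V)) where
  factors {X Y} g f hf := by
    let _ : Module K X := Module.compHom X (algebraMap K R)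
    let _ : Module K Y := Module.compHom Y (algebraMap K R)
    have : IsScalarTower K R X := IsScalarTower.of_algebraMap_smul fun _ _ => rfl
    have : IsScalarTower K R Y := IsScalarTower.of_algebraMap_smul fun _ _ => rfl
    have hinj : LinearMap.ker (f.hom.restrictScalars K) = ⊥ :=
      LinearMap.ker_eq_bot.2 ((ModuleCat.mono_iff_injective f).1 hf)
    obtain ⟨p, hp⟩ := LinearMap.exists_leftInverse_of_injective _ hinj
    have hp' (x : X) : p (f.hom x) = x := LinearMap.congr_fun hp x
    have hb (r : R) (l : P) (i : ι) : b.repr (r • l) i = r * b.repr l i := by simp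
    let G (x : X) : Coind K P V := g.hom x
    have hadd (x y : X) (q : P) : G (x + y) q = G x q + G y q :=
      DFunLike.congr_fun (map_add g.hom x y) q
    have hsmul (r : R) (x : X) (q : P) : G (r • x) q = G x (r • q) :=
      DFunLike.congr_fun (map_smul g.hom r x) q
    have hsmulK (c : K) (x : X) (q : P) : G (c • x) q = c • G x q := by
      rw [← algebraMap_smul R c x, hsmul, algebraMap_smul, map_smul]
    -- Under `Hom_R(Y, Hom_K(P, V)) = Hom_K(Y ⊗_R P, V)`, this extends a `K`-linear map from `X ⊗_R
    -- P` using the `K`-linear retraction `p`, in coordinates for the basis `b`.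
    let H (y : Y) : P →ₗ[K] V :=
      { toFun := fun l => ∑ i, G (p (b.repr l i • y)) (b i)
        map_add' := fun l m => by
          simp only [map_add, Finsupp.add_apply, add_smul, hadd, Finset.sum_add_distrib]
        map_smul' := fun c l => by
          simp only [RingHom.id_apply, Finset.smul_sum]
          refine Finset.sum_congr rfl fun i _ => ?_
          rw [← algebraMap_smul R c l, hb, mul_smul, algebraMap_smul, map_smul, hsmulK] }
    refine ⟨ModuleCat.ofHom
      { toFun := H
        map_add' := fun y y' => ext fun l => ?_
        map_smul' := fun r y => ext fun l => ?_ }, ?_⟩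
    · change ∑ i, G (p (b.repr l i • (y + y'))) (b i) =
        ∑ i, G (p (b.repr l i • y)) (b i) + ∑ i, G (p (b.repr l i • y')) (b i)
      simp only [smul_add, map_add, hadd, Finset.sum_add_distrib]
    · change ∑ i, G (p (b.repr l i • r • y)) (b i) = ∑ i, G (p (b.repr (r • l) i • y)) (b i)
      refine Finset.sum_congr rfl fun i _ => ?_
      rw [hb, mul_comm, mul_smul]
    · refine ModuleCat.hom_ext (LinearMap.ext fun x => ext fun l => ?_)
      change ∑ i, G (p (b.repr l i • f.hom x)) (b i) = G x l
      simp only [← map_smul, hp', hsmul]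
      rw [← map_sum, b.sum_repr]

variable (K) in
/-- The dual of the short exact sequence `0 → ker π → L → P → 0`. -/
def dualSequence (V : Type u) [AddCommGroup V] [Module K V] (π : Q →ₗ[R] P) :
    ShortComplex (ModuleCat.{u} R) :=
  ShortComplex.mk (ModuleCat.ofHom (precomp K V π))
    (ModuleCat.ofHom (precomp K V (LinearMap.ker π).subtype))
    (ModuleCat.hom_ext (LinearMap.ext fun φ => ext fun x => by
      change φ (π x) = 0
      rw [show π x = 0 from x.2, map_zero]))

lemma dualSequence_shortExact {π : Q →ₗ[R] P} (hπ : Function.Surjective π) :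
    (dualSequence K V π).ShortExact where
  exact := by
    rw [ShortComplex.moduleCat_exact_iff]
    intro (φ : Coind K Q V) (hφ : precomp K V (LinearMap.ker π).subtype φ = 0)
    obtain ⟨ψ, hψ⟩ := LinearMap.exists_comp_eq_of_ker_le (π.restrictScalars K)
      (show Q →ₗ[K] V from φ) (fun x hx => by
        exact DFunLike.congr_fun hφ (⟨x, hx⟩ : LinearMap.ker π))
    exact ⟨ψ, hψ⟩
  mono_f := by
    rw [ModuleCat.mono_iff_injective]
    intro (φ : Coind K P V) (ψ : Coind K P V) (h : precomp K V π φ = precomp K V π ψ)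
    refine ext fun x => ?_
    obtain ⟨y, rfl⟩ := hπ x
    exact DFunLike.congr_fun h y
  epi_g := by
    rw [ModuleCat.epi_iff_surjective]
    intro φ
    obtain ⟨ψ, hψ⟩ := LinearMap.exists_comp_eq_of_ker_le
      ((LinearMap.ker π).subtype.restrictScalars K) (show LinearMap.ker π →ₗ[K] V from φ)
      (by
        intro x hx
        rw [show x = 0 from Subtype.ext hx]
        exact zero_mem _)
    exact ⟨ψ, hψ⟩

/-- A functional `θ` killed by `J ^ t` vanishes on `J ^ t • N`, which by Artin–Rees contains `J ^ (k
+ t) • Q ∩ N`. It therefore extends `K`-linearly to `Q` so as to vanish on `J ^ (k + t) • Q`. -/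
lemma exists_torsion_lift [IsNoetherianRing R] (J : Ideal R) [Module.Finite R Q] (N : Submodule R Q)
    (t : ℕ) (θ : Coind K N V) (hθ : ∀ r ∈ J ^ t, r • θ = 0) :
    ∃ (s : ℕ) (_ : t ≤ s) (φ : Coind K Q V),
      (∀ r ∈ J ^ s, r • φ = 0) ∧ precomp K V N.subtype φ = θ := by
  obtain ⟨k, hk⟩ := J.exists_pow_inf_eq_pow_smul N
  have h1 := hk (k + t) (by omega)
  rw [Nat.add_sub_cancel_left] at h1
  set T : Submodule R Q := J ^ (k + t) • ⊤
  have hker : LinearMap.ker ((T.mkQ ∘ₗ N.subtype).restrictScalars K) ≤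
      LinearMap.ker (show N →ₗ[K] V from θ) := by
    intro x hx
    have hxT : (x : Q) ∈ T := by
      have : T.mkQ (x : Q) = 0 := hx
      rwa [Submodule.mkQ_apply, Submodule.Quotient.mk_eq_zero] at this
    have hx1 : (x : Q) ∈ T ⊓ N := ⟨hxT, x.2⟩
    rw [h1] at hx1
    have hx2 : (x : Q) ∈ J ^ t • N := Submodule.smul_mono le_rfl inf_le_right hx1
    have key : ∀ y ∈ J ^ t • N, ∀ hy : y ∈ N, θ ⟨y, hy⟩ = 0 := by
      intro y hy
      induction hy using Submodule.smul_induction_on' with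
      | smul r hr n hn =>
        intro hy
        exact DFunLike.congr_fun (hθ r hr) ⟨n, hn⟩
      | add a ha b hb iha ihb =>
        intro hy
        have := map_add θ ⟨a, Submodule.smul_le_right ha⟩ ⟨b, Submodule.smul_le_right hb⟩
        refine Eq.trans this ?_
        rw [iha, ihb, add_zero]
    exact key x hx2 x.2
  obtain ⟨φ, hφ⟩ := LinearMap.exists_comp_eq_of_ker_le _ _ hker
  refine ⟨k + t, by omega, LinearMap.comp φ (T.mkQ.restrictScalars K), fun r hr => ?_, hφ⟩
  refine ext fun x => ?_
  change φ (T.mkQ (r • x)) = 0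
  rw [Submodule.mkQ_apply,
    (Submodule.Quotient.mk_eq_zero T).2 (Submodule.smul_mem_smul hr Submodule.mem_top), map_zero]

/-- Presenting `P` by a finite free module embeds `Hom_K(P, V)` in an injective module with quotient
`Hom_K(ker π, V)`. Degree `1` is then `exists_torsion_lift`; higher degrees shift down to `ker π`,
which is again finite. -/
theorem extColimAcyclic [IsNoetherianRing R] (J : Ideal R) [Module.Finite R P] :
    ExtColimAcyclic J (ModuleCat.of R (Coind K P V)) := by
  intro i
  suffices h : ∀ (P : Type u) [AddCommGroup P] [Module K P] [Module R P] [IsScalarTower K R P]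
      [Module.Finite R P] (t : ℕ) (ξ : Abelian.Ext (quotPow J t)
        (ModuleCat.of R (Coind K P V)) (i + 1)), ∃ (s : ℕ) (h : t ≤ s), extRes h ξ = 0 from h P
  clear! P
  induction i with
  | zero =>
    intro P _ _ _ _ _ t ξ
    obtain ⟨m, π, hπ⟩ := Module.Finite.exists_fin' R P
    have hS := dualSequence_shortExact (K := K) (V := V) hπ
    have hinj : Injective (dualSequence K V π).X₂ :=
      injective_of_basis (Pi.basisFun R (Fin m))
    obtain ⟨ζ, rfl⟩ := Abelian.Ext.covariant_sequence_exact₁ _ hS ξ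
      (Abelian.Ext.eq_zero_of_injective _) rfl
    obtain ⟨g, rfl⟩ := (Abelian.Ext.mk₀_bijective _ _).2 ζ
    obtain ⟨s, hs, φ, hφ, hφθ⟩ := exists_torsion_lift J (LinearMap.ker π) t
      (g.hom (Ideal.Quotient.mk (J ^ t) 1)) (fun r hr => smul_apply_one_eq_zero g hr)
    refine ⟨s, hs, ?_⟩
    let η : quotPow J s ⟶ (dualSequence K V π).X₂ := homOfTorsion φ hφ
    have h1 : quotPowMap J hs ≫ g = η ≫ (dualSequence K V π).g :=
      quotPow_hom_ext (hφθ.symm.trans (congrArg (precomp K V (LinearMap.ker π).subtype)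
        (homOfTorsion_one (M := ModuleCat.of R (Coind K (Fin m → R) V)) φ hφ).symm))
    change extRes hs (M := (dualSequence K V π).X₁) _ = 0
    rw [extRes_comp, extRes_mk₀, h1, ← Abelian.Ext.mk₀_comp_mk₀,
      Abelian.Ext.comp_assoc_of_second_deg_zero, hS.comp_extClass, Abelian.Ext.comp_zero]
  | succ i ih =>
    intro P _ _ _ _ _ t ξ
    obtain ⟨m, π, hπ⟩ := Module.Finite.exists_fin' R P
    have hS := dualSequence_shortExact (K := K) (V := V) hπ
    have hinj : Injective (dualSequence K V π).X₂ :=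
      injective_of_basis (Pi.basisFun R (Fin m))
    obtain ⟨ζ, rfl⟩ := Abelian.Ext.covariant_sequence_exact₁ _ hS ξ
      (Abelian.Ext.eq_zero_of_injective _) rfl
    obtain ⟨s, hs, h0⟩ := ih (LinearMap.ker π) t ζ
    refine ⟨s, hs, ?_⟩
    change extRes hs (M := (dualSequence K V π).X₁) _ = 0
    rw [extRes_comp]
    exact (congrArg (fun α => Abelian.Ext.comp α hS.extClass rfl) h0).trans
      (Abelian.Ext.zero_comp ..)

end Coind

/-! ### Coinduced embeddings and restriction of scalars along a finite endomorphism. -/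

section

variable (K : Type*) [Field K] {R : Type u} [CommRing R] [Algebra K R]

/-- The coinduced module `Hom_K(R, M)`. -/
noncomputable def coind (M : ModuleCat.{u} R) : ModuleCat.{u} R :=
  ModuleCat.of R (Coind K R ((ModuleCat.restrictScalars (algebraMap K R)).obj M))

/-- The embedding of `M` into its coinduced module. -/
noncomputable def coindι (M : ModuleCat.{u} R) : M ⟶ coind K M :=
  ModuleCat.ofHom (Y := Coind K R ((ModuleCat.restrictScalars (algebraMap K R)).obj M))
    { toFun := fun m =>
        { toFun := fun r => (r • m : M)
          map_add' := fun r s => add_smul r s m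
          map_smul' := fun c r => by
            rw [Algebra.smul_def, mul_smul]
            rfl }
      map_add' := fun m m' => Coind.ext fun r => smul_add r m m'
      map_smul' := fun s m => Coind.ext fun r => by
        change r • s • m = (s • r) • m
        rw [smul_eq_mul, mul_comm, mul_smul] }

instance (M : ModuleCat.{u} R) : Mono (coindι K M) := by
  rw [ModuleCat.mono_iff_injective]
  intro m m' h
  have h1 : (1 : R) • m = (1 : R) • m' := DFunLike.congr_fun (F := Coind K R _) h 1
  simpa using h1

/-- The map of coinduced modules given by postcomposition. -/
noncomputable def coindMap {M M' : ModuleCat.{u} R} (f : M ⟶ M') : coind K M ⟶ coind K M' :=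
  ModuleCat.ofHom (X := Coind K R ((ModuleCat.restrictScalars (algebraMap K R)).obj M))
    (Y := Coind K R ((ModuleCat.restrictScalars (algebraMap K R)).obj M'))
    { toFun := fun φ =>
        LinearMap.comp ((ModuleCat.restrictScalars (algebraMap K R)).map f).hom φ
      map_add' := fun _ _ => Coind.ext fun _ => map_add f.hom _ _
      map_smul' := fun _ _ => rfl }

lemma coindι_naturality {M M' : ModuleCat.{u} R} (f : M ⟶ M') :
    coindι K M ≫ coindMap K f = f ≫ coindι K M' :=
  ModuleCat.hom_ext (LinearMap.ext fun m => Coind.ext fun r => map_smul f.hom r m)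

/-- The short exact sequence embedding `M` into its coinduced module. -/
noncomputable def coindSequence (M : ModuleCat.{u} R) : ShortComplex (ModuleCat.{u} R) :=
  ShortComplex.mk (coindι K M) (cokernel.π (coindι K M)) (cokernel.condition _)

lemma coindSequence_shortExact (M : ModuleCat.{u} R) : (coindSequence K M).ShortExact where
  exact := ShortComplex.exact_cokernel _
  mono_f := inferInstanceAs (Mono (coindι K M))
  epi_g := inferInstanceAs (Epi (cokernel.π (coindι K M)))

/-- Functoriality of `coindSequence`. -/
noncomputable def coindSequenceMap {M M' : ModuleCat.{u} R} (f : M ⟶ M') :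
    coindSequence K M ⟶ coindSequence K M' where
  τ₁ := f
  τ₂ := coindMap K f
  τ₃ := cokernel.map _ _ f (coindMap K f) (coindι_naturality K f)
  comm₁₂ := (coindι_naturality K f).symm
  comm₂₃ := (cokernel.π_desc _ _ _).symm

variable {K}

lemma extColimAcyclic_coind [IsNoetherianRing R] (J : Ideal R) (M : ModuleCat.{u} R) :
    ExtColimAcyclic J (coind K M) :=
  Coind.extColimAcyclic J

/-- Restricting `Hom_K(R, M)` along `F` gives `Hom_K(P, M)`, where `P` is `R` with action through
`F`, a finite module. -/
lemma extColimAcyclic_restrictScalars_coind [IsNoetherianRing R] (J : Ideal R) (F : R →ₐ[K] R)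
    (hF : F.toRingHom.Finite) (M : ModuleCat.{u} R) :
    ExtColimAcyclic J ((ModuleCat.restrictScalars F.toRingHom).obj (coind K M)) := by
  let P := (ModuleCat.restrictScalars F.toRingHom).obj (ModuleCat.of R R)
  let _ : Module K P := (Algebra.toModule : Module K R)
  have : IsScalarTower K R P := ⟨fun c r (x : R) => by
    change F (c • r) * x = c • (F r * x)
    rw [map_smul, smul_mul_assoc]⟩
  have : Module.Finite R P := hF
  let V := (ModuleCat.restrictScalars (algebraMap K R)).obj M
  let e : Coind K P V ≃ₗ[R] (ModuleCat.restrictScalars F.toRingHom).obj (coind K M) :=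
    { toFun := fun φ => φ
      invFun := fun φ => φ
      left_inv := fun _ => rfl
      right_inv := fun _ => rfl
      map_add' := fun _ _ => rfl
      map_smul' := fun _ _ => rfl }
  exact (Coind.extColimAcyclic (K := K) (P := P) (V := V) J).of_iso e.toModuleIso

/-- The annihilator of `x` contains the ideal generated by `F(J ^ t)`, which is `(J.map F) ^ t` and
so contains `J ^ (c * t)`. -/
lemma forall_pow_smul_of_restrictScalars {J : Ideal R} {F : R →+* R} {c : ℕ}
    (hc : J ^ c ≤ J.map F) {N : ModuleCat.{u} R} {x : N} {t : ℕ}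
    (hx : ∀ r ∈ J ^ t, F r • x = 0) : ∀ r ∈ J ^ (c * t), r • x = 0 := by
  have h : J ^ (c * t) ≤ Ideal.span (F '' (J ^ t : Ideal R)) := by
    rw [pow_mul]
    exact (Ideal.pow_right_mono hc t).trans (Ideal.map_pow F J t).ge
  have h2 : Ideal.span (F '' (J ^ t : Ideal R)) ≤ Ideal.torsionOf R N x := by
    rw [Ideal.span_le]
    rintro _ ⟨r, hr, rfl⟩
    exact hx r hr
  exact fun r hr => h2 (h hr)

/-- Vanishing of maps on local cohomology is preserved by restriction of scalars along a finite
ring endomorphism under which the ideal is stable up to radical. -/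
theorem ExtColimMapZero.restrictScalars [IsNoetherianRing R] {J : Ideal R} (F : R →ₐ[K] R)
    (hF : F.toRingHom.Finite) {c : ℕ} (hc : J ^ c ≤ J.map F.toRingHom)
    (hJ : J.map F.toRingHom ≤ J) (i : ℕ) {M M' : ModuleCat.{u} R} (f : M ⟶ M')
    (h : ExtColimMapZero J i f) :
    ExtColimMapZero J i ((ModuleCat.restrictScalars F.toRingHom).map f) := by
  have hpow {s : ℕ} {r : R} (hr : r ∈ J ^ s) : F r ∈ J ^ s := by
    have h1 : F r ∈ (J ^ s).map F.toRingHom := Ideal.mem_map_of_mem F.toRingHom hr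
    rw [Ideal.map_pow] at h1
    exact Ideal.pow_right_mono hJ s h1
  induction i generalizing M M' with
  | zero =>
    rw [extColimMapZero_zero_iff] at h ⊢
    intro t x hx
    exact h (c * t) x (forall_pow_smul_of_restrictScalars hc hx)
  | succ i ih =>
    let G := ModuleCat.restrictScalars.{u} F.toRingHom
    have hS := coindSequence_shortExact K M
    have hS' := coindSequence_shortExact K M'
    have hφ := ExtColimMapZero.factors (coindSequenceMap K f) hS hS' h
    let φ : (coindSequence K M).map G ⟶ (coindSequence K M').map G :=
      G.mapShortComplex.map (coindSequenceMap K f)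
    suffices hG : ExtColimFactors J i φ by
      have hac : ExtColimAcyclic J ((coindSequence K M).map G).X₂ :=
        extColimAcyclic_restrictScalars_coind J F hF M
      exact ExtColimFactors.mapZero φ (hS.map_of_exact G) (hS'.map_of_exact G) hac hG
    cases i with
    | zero =>
      rw [extColimFactors_zero_iff] at hφ ⊢
      intro t x hx
      -- Torsion passes in both directions: `hc` handles `x`, and `hJ` (through `hpow`) handles `y`.
      obtain ⟨s, y, hy, hyx⟩ := hφ (c * t) x (forall_pow_smul_of_restrictScalars hc hx)
      exact ⟨s, y, fun r hr => hy _ (hpow hr), hyx⟩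
    | succ i =>
      -- In positive degree the acyclic middle term turns factoring into vanishing on the cokernels,
      -- where the induction hypothesis applies.
      exact ExtColimMapZero.factors_τ₃ _
        (ih _ (hφ.mapZero_τ₃ _ (extColimAcyclic_coind J M')))

end

lemma exists_pow_smul_eq_zero_of_isFiniteLength {R : Type u} [CommRing R] {J : Ideal R}
    {M : Type*} [AddCommGroup M] [Module R M] (hM : IsFiniteLength R M)
    (h : ∀ x : M, ∃ t : ℕ, ∀ r ∈ J ^ t, r • x = 0) :
    ∃ N : ℕ, ∀ r ∈ J ^ N, ∀ x : M, r • x = 0 := by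
  have := (isFiniteLength_iff_isNoetherian_isArtinian.1 hM).1
  obtain ⟨s, hs⟩ := (Module.finite_def.1 (inferInstance : Module.Finite R M))
  choose t ht using h
  refine ⟨s.sup t, fun r hr x => ?_⟩
  have hx : x ∈ Submodule.span R (s : Set M) := hs ▸ Submodule.mem_top
  induction hx using Submodule.span_induction with
  | mem x hx => exact ht x r (Ideal.pow_le_pow_right (Finset.le_sup hx) hr)
  | zero => exact smul_zero r
  | add x y _ _ hx hy => rw [smul_add, hx, hy, add_zero]
  | smul a x _ hx => rw [smul_comm, hx, smul_zero]

/-! ### Roots of monomials, splitting `expand k`. -/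

namespace MvPolynomial

variable {σ : Type*} {K : Type u} [Field K] (k : ℕ)

open Classical in
/-- The `K`-linear map sending a monomial to its `k`-th root if it is a `k`-th power, and to `0`
otherwise. -/
noncomputable def contract : MvPolynomial σ K →ₗ[K] MvPolynomial σ K :=
  (basisMonomials σ K).constr K fun a =>
    if ∀ j, k ∣ a j then monomial (a.mapRange (· / k) (Nat.zero_div k)) 1 else 0

open Classical in
lemma contract_monomial (a : σ →₀ ℕ) (c : K) : contract k (monomial a c) =
    if ∀ j, k ∣ a j then monomial (a.mapRange (· / k) (Nat.zero_div k)) c else 0 := by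
  have h1 : monomial a c = c • basisMonomials σ K a := by
    rw [coe_basisMonomials, smul_monomial, smul_eq_mul, mul_one]
  rw [h1, map_smul, contract, Module.Basis.constr_basis, smul_ite, smul_monomial, smul_eq_mul,
    mul_one, smul_zero]

lemma contract_one : contract k (1 : MvPolynomial σ K) = 1 := by
  rw [← C_1, C_apply, contract_monomial]
  simp

variable {k}

lemma contract_expand_mul (hk : 0 < k) (p q : MvPolynomial σ K) :
    contract k (expand k p * q) = p * contract k q := by
  classical
  induction p using MvPolynomial.induction_on' with
  | add p p' hp hp' => rw [map_add, add_mul, map_add, hp, hp', add_mul]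
  | monomial a c =>
    induction q using MvPolynomial.induction_on' with
    | add q q' hq hq' => rw [mul_add, map_add, hq, hq', map_add, mul_add]
    | monomial b d =>
      rw [expand_monomial, monomial_mul, contract_monomial, contract_monomial, mul_ite, mul_zero,
        monomial_mul]
      have h1 : (∀ j, k ∣ (k • a + b) j) ↔ ∀ j, k ∣ b j := by
        refine forall_congr' fun j => ?_
        simp only [Finsupp.add_apply, Finsupp.smul_apply, smul_eq_mul]
        exact (Nat.dvd_add_right (dvd_mul_right k (a j)))
      have h2 : (k • a + b).mapRange (· / k) (Nat.zero_div k) =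
          a + b.mapRange (· / k) (Nat.zero_div k) := by
        ext j
        simp [Nat.mul_add_div hk]
      simp only [h1, h2]

end MvPolynomial

/-! ### The power endomorphism of a Stanley–Reisner ring and its splitting. -/

namespace IsStanleyReisnerIdeal

open MvPolynomial

variable {K : Type u} [Field K] {n : ℕ} {I : Ideal (MvPolynomial (Fin n) K)} {k : ℕ}

lemma le_comap_expand (hI : IsStanleyReisnerIdeal I) (hk : 0 < k) :
    I ≤ I.comap (expand k : MvPolynomial (Fin n) K →ₐ[K] MvPolynomial (Fin n) K) := by
  obtain ⟨G, rfl⟩ := hI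
  rw [Ideal.span_le]
  rintro _ ⟨F, hF, rfl⟩
  have h : (expand k (∏ j ∈ F, X j) : MvPolynomial (Fin n) K) = (∏ j ∈ F, X j) ^ k := by
    simp [map_prod, Finset.prod_pow]
  change (expand k (∏ j ∈ F, X j) : MvPolynomial (Fin n) K) ∈ Ideal.span _
  rw [h]
  exact Ideal.pow_mem_of_mem _ (Ideal.subset_span (Set.mem_image_of_mem _ hF)) k hk

/-- This is where square-freeness enters. If a square-free monomial divides a `k`-th power, each of
its variables has positive exponent divisible by `k` there, so it already divides the `k`-th root.
-/
lemma contract_mem (hI : IsStanleyReisnerIdeal I) (hk : 0 < k) {p : MvPolynomial (Fin n) K}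
    (hp : p ∈ I) : contract k p ∈ I := by
  classical
  obtain ⟨G, rfl⟩ := hI
  induction hp using Submodule.closure_induction with
  | zero => rw [map_zero]; exact zero_mem _
  | add p q _ _ hp hq => rw [map_add]; exact add_mem hp hq
  | smul_mem q x hx =>
    obtain ⟨F, hF, rfl⟩ := hx
    set e : Fin n →₀ ℕ := ∑ j ∈ F, Finsupp.single j 1
    have he : (∏ j ∈ F, X j : MvPolynomial (Fin n) K) = monomial e 1 :=
      (monomial_sum_one F _).symm
    have hmem : (monomial e 1 : MvPolynomial (Fin n) K) ∈
        Ideal.span ((fun F : Finset (Fin n) => ∏ j ∈ F, X j) '' G) :=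
      he ▸ Ideal.subset_span ⟨F, hF, rfl⟩
    simp only [he, smul_eq_mul]
    induction q using MvPolynomial.induction_on' with
    | add p p' hp hp' => rw [add_mul, map_add]; exact add_mem hp hp'
    | monomial a c =>
      rw [monomial_mul, contract_monomial]
      split_ifs with h
      · have hle : e ≤ (a + e).mapRange (· / k) (Nat.zero_div k) := by
          intro j
          rw [Finsupp.mapRange_apply]
          have hej : e j ≤ 1 := by
            simp only [e, Finsupp.finsetSum_apply, Finsupp.single_apply, Finset.sum_ite_eq']
            split_ifs <;> omega
          rcases Nat.eq_zero_or_pos (e j) with h0 | h0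
          · rw [h0]; exact Nat.zero_le _
          · refine hej.trans ((Nat.one_le_div_iff hk).2 (Nat.le_of_dvd ?_ (h j)))
            rw [Finsupp.add_apply]
            omega
        obtain ⟨b, hb⟩ := exists_add_of_le hle
        rw [hb, add_comm e b, ← mul_one (c * 1), ← monomial_mul]
        exact Ideal.mul_mem_left _ _ hmem
      · exact zero_mem _

/-- The endomorphism of `K[X_1, …, X_n] / I` sending `x_j` to `x_j ^ k`. -/
noncomputable def expandEnd (hI : IsStanleyReisnerIdeal I) (hk : 0 < k) :
    (MvPolynomial (Fin n) K ⧸ I) →ₐ[K] (MvPolynomial (Fin n) K ⧸ I) :=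
  Ideal.quotientMapₐ I (expand k) (hI.le_comap_expand hk)

lemma expandEnd_mk (hI : IsStanleyReisnerIdeal I) (hk : 0 < k) (p : MvPolynomial (Fin n) K) :
    hI.expandEnd hk (Ideal.Quotient.mk I p) = Ideal.Quotient.mk I (expand k p) :=
  rfl

lemma expandEnd_mk_X (hI : IsStanleyReisnerIdeal I) (hk : 0 < k) (j : Fin n) :
    hI.expandEnd hk (Ideal.Quotient.mk I (X j)) = Ideal.Quotient.mk I (X j) ^ k := by
  rw [expandEnd_mk, expand_X, map_pow]

/-- The target is of finite type, and each `x_j` is integral because `x_j ^ k` lies in the image. -/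
lemma expandEnd_finite (hI : IsStanleyReisnerIdeal I) (hk : 0 < k) :
    (hI.expandEnd hk).toRingHom.Finite := by
  refine RingHom.IsIntegral.to_finite ?_ ?_
  · intro x
    obtain ⟨p, rfl⟩ := Ideal.Quotient.mk_surjective x
    induction p using MvPolynomial.induction_on with
    | C a =>
      have h : (hI.expandEnd hk).toRingHom (Ideal.Quotient.mk I (C a)) =
          Ideal.Quotient.mk I (C a) :=
        congrArg (Ideal.Quotient.mk I) (expand_C k a)
      rw [← h]
      exact RingHom.isIntegralElem_map _
    | add p q hp hq =>
      rw [map_add]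
      exact RingHom.IsIntegralElem.add _ hp hq
    | mul_X p j hp =>
      rw [map_mul]
      refine RingHom.IsIntegralElem.mul _ hp ?_
      let _ := (hI.expandEnd hk).toRingHom.toAlgebra
      refine IsIntegral.of_pow (R := MvPolynomial (Fin n) K ⧸ I) hk ?_
      rw [← hI.expandEnd_mk_X hk]
      exact RingHom.isIntegralElem_map _
  · refine RingHom.FiniteType.of_comp_finiteType
      (f := algebraMap K (MvPolynomial (Fin n) K ⧸ I)) ?_
    have h : (hI.expandEnd hk).toRingHom.comp (algebraMap K (MvPolynomial (Fin n) K ⧸ I)) =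
        algebraMap K (MvPolynomial (Fin n) K ⧸ I) := (hI.expandEnd hk).comp_algebraMap
    rw [h, RingHom.finiteType_algebraMap]
    infer_instance

/-- The splitting of `expandEnd`, as an additive map on the quotient ring. -/
noncomputable def contractEnd (hI : IsStanleyReisnerIdeal I) (hk : 0 < k) :
    (MvPolynomial (Fin n) K ⧸ I) →+ (MvPolynomial (Fin n) K ⧸ I) :=
  QuotientAddGroup.map I.toAddSubgroup I.toAddSubgroup (contract k).toAddMonoidHom
    fun _ hp => hI.contract_mem hk hp

lemma contractEnd_mk (hI : IsStanleyReisnerIdeal I) (hk : 0 < k) (p : MvPolynomial (Fin n) K) :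
    hI.contractEnd hk (Ideal.Quotient.mk I p) = Ideal.Quotient.mk I (contract k p) :=
  rfl

lemma contractEnd_one (hI : IsStanleyReisnerIdeal I) (hk : 0 < k) : hI.contractEnd hk 1 = 1 := by
  rw [← map_one (Ideal.Quotient.mk I), contractEnd_mk, contract_one]

lemma contractEnd_expandEnd_mul (hI : IsStanleyReisnerIdeal I) (hk : 0 < k)
    (r s : MvPolynomial (Fin n) K ⧸ I) :
    hI.contractEnd hk (hI.expandEnd hk r * s) = r * hI.contractEnd hk s := by
  obtain ⟨p, rfl⟩ := Ideal.Quotient.mk_surjective r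
  obtain ⟨q, rfl⟩ := Ideal.Quotient.mk_surjective s
  rw [expandEnd_mk, ← map_mul, contractEnd_mk, contractEnd_mk, ← map_mul, contract_expand_mul hk]

lemma map_expandEnd_le (hI : IsStanleyReisnerIdeal I) (hk : 0 < k) :
    (gradedMaximalIdeal I).map (hI.expandEnd hk).toRingHom ≤ gradedMaximalIdeal I := by
  rw [gradedMaximalIdeal, Ideal.map_span, Ideal.span_le]
  rintro _ ⟨_, ⟨j, rfl⟩, rfl⟩
  change hI.expandEnd hk _ ∈ _
  rw [expandEnd_mk_X]
  exact Ideal.pow_mem_of_mem _ (Ideal.subset_span (Set.mem_range_self j)) k hk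

lemma exists_pow_le_map_expandEnd (hI : IsStanleyReisnerIdeal I) (hk : 0 < k) :
    ∃ c : ℕ, gradedMaximalIdeal I ^ c ≤
      (gradedMaximalIdeal I).map (hI.expandEnd hk).toRingHom := by
  refine Ideal.exists_pow_le_of_le_radical_of_fg ?_ (IsNoetherian.noetherian _)
  conv_lhs => rw [gradedMaximalIdeal]
  rw [Ideal.span_le]
  rintro _ ⟨j, rfl⟩
  refine ⟨k, ?_⟩
  dsimp only
  rw [← hI.expandEnd_mk_X hk]
  exact Ideal.mem_map_of_mem (hI.expandEnd hk).toRingHom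
    (Ideal.subset_span (Set.mem_range_self j))

/-- If a power `x ^ k` maps to zero, so does `x`, by restriction along `expandEnd`. -/
lemma extColimMapZero_X (hI : IsStanleyReisnerIdeal I) (hk : 0 < k) (i : ℕ) (j : Fin n)
    (h : ExtColimMapZero (gradedMaximalIdeal I) i
      (Ideal.Quotient.mk I (X j) ^ k • 𝟙 (ModuleCat.of (MvPolynomial (Fin n) K ⧸ I) (MvPolynomial (Fin n) K ⧸ I)))) :
    ExtColimMapZero (gradedMaximalIdeal I) i
      (Ideal.Quotient.mk I (X j) • 𝟙 (ModuleCat.of (MvPolynomial (Fin n) K ⧸ I) (MvPolynomial (Fin n) K ⧸ I))) := by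
  obtain ⟨c, hc⟩ := hI.exists_pow_le_map_expandEnd hk
  have h1 := h.restrictScalars (hI.expandEnd hk) (hI.expandEnd_finite hk) hc
    (hI.map_expandEnd_le hk)
  let A := MvPolynomial (Fin n) K ⧸ I
  let G := ModuleCat.restrictScalars.{u} (hI.expandEnd hk).toRingHom
  let a : A →ₗ[A] G.obj (ModuleCat.of A A) :=
    { toFun := hI.expandEnd hk
      map_add' := map_add _
      map_smul' := map_mul (hI.expandEnd hk) }
  let b : G.obj (ModuleCat.of A A) →ₗ[A] A :=
    { toFun := hI.contractEnd hk
      map_add' := map_add _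
      map_smul' := hI.contractEnd_expandEnd_mul hk }
  -- The factorization through `F_*R`: the composite sends `x` to the contraction of `x_j ^ k * F x
  -- = F (x_j * x)`, which is `x_j * x`.
  convert h1.comp (ModuleCat.ofHom a) (ModuleCat.ofHom b)
  refine ModuleCat.hom_ext (LinearMap.ext fun x => ?_)
  change Ideal.Quotient.mk I (X j) * x =
    hI.contractEnd hk (Ideal.Quotient.mk I (X j) ^ k * hI.expandEnd hk x)
  rw [← expandEnd_mk_X hI hk, ← map_mul, ← mul_one (hI.expandEnd hk _),
    contractEnd_expandEnd_mul, contractEnd_one, mul_one]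

end IsStanleyReisnerIdeal

/-! ### Conclusion. -/

theorem mainTheorem7 {K : Type u} [Field K] (n : ℕ) (I : Ideal (MvPolynomial (Fin n) K))
    (hI : IsStanleyReisnerIdeal I)
    (hR : IsGeneralizedCohenMacaulay (gradedMaximalIdeal I)) :
    IsKBuchsbaum (gradedMaximalIdeal I) 1 := by
  intro i hi r hr x
  obtain ⟨N, hN⟩ := exists_pow_smul_eq_zero_of_isFiniteLength (J := gradedMaximalIdeal I)
    (hR i hi) localCohomology.exists_pow_smul_eq_zero
  rw [pow_one] at hr
  have hX (j : Fin n) (y : ringLocalCohomology (gradedMaximalIdeal I) i) :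
      Ideal.Quotient.mk I (MvPolynomial.X j) • y = 0 := by
    -- The exponent is `N + 1` because `N` may be `0`, while the power endomorphism requires `k >
    -- 0`.
    have h1 : ExtColimMapZero (gradedMaximalIdeal I) i
        (Ideal.Quotient.mk I (MvPolynomial.X j) ^ (N + 1) •
          𝟙 (ModuleCat.of (MvPolynomial (Fin n) K ⧸ I) (MvPolynomial (Fin n) K ⧸ I))) := by
      rw [← localCohomology.map_eq_zero_iff]
      refine ModuleCat.hom_ext (LinearMap.ext fun z => ?_)
      rw [localCohomology.map_smul_id]
      exact hN _ (Ideal.pow_le_pow_right N.le_succ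
        (Ideal.pow_mem_pow (Ideal.subset_span (Set.mem_range_self j)) _)) z
    have h2 := hI.extColimMapZero_X N.succ_pos i j h1
    rw [← localCohomology.map_eq_zero_iff] at h2
    rw [← localCohomology.map_smul_id, h2]
    rfl
  have hle : gradedMaximalIdeal I ≤ Ideal.torsionOf _ _ x :=
    Ideal.span_le.2 (by rintro _ ⟨j, rfl⟩; exact hX j x)
  exact hle hr
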